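/- For $n\ge 2$ let $\mathcal K^n$ be the set of convex bodies (non-empty compact convex sets) in $\mathbb R^n$, and let $\dim$ denote the dimension of the affine hull. For $K,E\in\mathcal K^n$ there are unique real numbers $W_0(K;E),\dots,W_n(K;E)$ (the relative quermassintegrals) with $$\mathrm{vol}(K+\lambda E)=\sum_{i=0}^n\binom ni W_i(K;E)\,\lambda^i\qquad\text{for all real }\lambda\ge 0,$$ where $\mathrm{vol}$ is $n$-dimensional Lebesgue measure; put $f_{K;E}(z)=\sum_{i=0}^n\binom ni W_i(K;E)\,z^i$ for $z\in\mathbb C$ (the relative Steiner polynomial). Let $\mathbb C^+=\{z\in\mathbb C:\operatorname{Im} z\ge 0\}$, let $\mathbb R_{>0}$ be the positive real axis, and let $$\mathcal R(n)=\{z\in\mathbb C^+: f_{K;E}(z)=0\text{ for some }K,E\in\mathcal K^n\text{ with }\dim(K+E)=n\}.$$ **Theorem 1.8.** For every $\gamma\in\mathbb C^+\setminus\mathbb R_{>0}$ there exists $n_\gamma\ge 2$ such that $\gamma\in\mathcal R(n)$ for all $n\ge n_\gamma$. In particular, $\bigcup_{n\ge 2}\mathcal R(n)=\mathbb C^+\setminus\mathbb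 R_{>0}$. -/

import Mathlib

open MeasureTheory Polynomial
open scoped Pointwise

namespace Steiner

/-- Convex bodies (non-empty compact convex sets) of the Euclidean space of dimension `n`. -/
abbrev Body (n : ℕ) : Type := ConvexBody (EuclideanSpace ℝ (Fin n))

/-- The dimension of a convex body, that is, of its affine hull. -/
noncomputable def dim {n : ℕ} (K : Body n) : ℕ :=
  Module.finrank ℝ (vectorSpan ℝ (K : Set (EuclideanSpace ℝ (Fin n))))

/-- `W 0, …, W n` are the relative quermassintegrals of `K` with respect to `E`: the relative
Steiner formula `vol (K + t E) = ∑ i, (n choose i) * W i * t ^ i` holds for all real `t ≥ 0`.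
The numbers `W i` are determined by `K` and `E`, see `IsQuermassintegrals.unique`. -/
def IsQuermassintegrals {n : ℕ} (K E : Body n) (W : Fin (n + 1) → ℝ) : Prop :=
  ∀ t : ℝ, 0 ≤ t →
    (volume : Measure (EuclideanSpace ℝ (Fin n))).real
        ((K + t • E : Body n) : Set (EuclideanSpace ℝ (Fin n)))
      = ∑ i : Fin (n + 1), (n.choose i : ℝ) * W i * t ^ (i : ℕ)

theorem IsQuermassintegrals.unique {n : ℕ} {K E : Body n} {W W' : Fin (n + 1) → ℝ}
    (h : IsQuermassintegrals K E W) (h' : IsQuermassintegrals K E W') : W = W' := by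
  let p : (Fin (n + 1) → ℝ) → ℝ[X] := fun V =>
    ∑ i : Fin (n + 1), Polynomial.C ((n.choose i : ℝ) * V i) * X ^ (i : ℕ)
  have hp : p W = p W' := by
    refine Polynomial.eq_of_infinite_eval_eq _ _ ((Set.Ici_infinite (0 : ℝ)).mono ?_)
    intro t ht
    have := (h t ht).symm.trans (h' t ht)
    simpa [p, Polynomial.eval_finsetSum] using this
  funext i
  have hc : ∀ V, (p V).coeff (i : ℕ) = (n.choose i : ℝ) * V i := by
    intro V
    simp only [p, Polynomial.finsetSum_coeff, Polynomial.coeff_C_mul_X_pow]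
    rw [Finset.sum_eq_single i]
    · simp
    · intro j _ hj
      rw [if_neg]
      intro hij
      exact hj (Fin.ext hij.symm)
    · simp
  have h1 := hc W
  rw [hp, hc W'] at h1
  have h2 : (n.choose i : ℝ) ≠ 0 := by
    exact_mod_cast (Nat.choose_pos (Nat.lt_succ_iff.mp i.2)).ne'
  exact (mul_left_cancel₀ h2 h1).symm

/-- `f` is the relative Steiner polynomial of `K` and `E`, as a polynomial in a complex
variable. -/
def IsSteinerPolynomial {n : ℕ} (K E : Body n) (f : ℂ[X]) : Prop :=
  ∃ W : Fin (n + 1) → ℝ, IsQuermassintegrals K E W ∧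
    f = ∑ i : Fin (n + 1), Polynomial.C ((n.choose i : ℂ) * (W i : ℂ)) * X ^ (i : ℕ)

/-- The closed upper half-plane. -/
def upperHalf : Set ℂ := {z | 0 ≤ z.im}

/-- The positive real axis, as a subset of the complex plane. -/
def posReal : Set ℂ := {z | 0 < z.re ∧ z.im = 0}

/-- The set of all roots, in the closed upper half-plane, of the relative Steiner polynomials of
pairs of convex bodies `K`, `E` with `dim (K + E) = n`. -/
def rootCone (n : ℕ) : Set ℂ :=
  {z | z ∈ upperHalf ∧ ∃ (K E : Body n) (f : ℂ[X]),
    dim (K + E) = n ∧ IsSteinerPolynomial K E f ∧ f.IsRoot z}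

end Steiner

/-! A positive real `t` is never a root: `K + t • E` contains a translate of a positive multiple of
`K + E`, so its volume is positive.

For the converse, let `K` be the union over `u` in `[0,1]` of boxes with `k` sides `s + c(1-u)` and
`l` sides `u`, and `E` a flat `k`-cube. Integrating over `u` makes the Steiner polynomial a constant
times `∑_{i≤k} C(n,i) c^(k-i) (s+z)^i`, `n = k+l+1`. For `c > 0` its roots are `c w - s`, with `w` a
root of the truncation `p` of `(1+X)^n` at degree `k`. Scaling and shifting left thus reach every
`γ` with `Im γ > 0`, once some `w` in the open upper half-plane satisfies `Re γ / Im γ ≤ Re w / Im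
w`.

Such roots exist (`exists_root_truncBinom`). If all roots avoided a sector around the positive axis,
`g(x) = x p'(x)/p(x) = ∑ x/(x-w)` would have multiplicative second differences of order `k (a-1)²`.
But `g` is about `nx/(1+x)` below `x = k/(n-k)` and about `k` above: this kink forces a second
difference of order `k (a-1)`. The required `k` does not depend on `n`, so all large `n` are
covered. -/

namespace Steiner

/-! ### Roots outside a sector and the logarithmic derivative -/

/-- The complement of the sector around the positive axis stays away from that axis. -/
lemma le_norm_ofReal_sub {M x : ℝ} (hM : 1 ≤ M) {z : ℂ}
    (hz : z.re ≤ M * |z.im|) : x ≤ 2 * M * ‖(x : ℂ) - z‖ := by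
  have h1 := Complex.abs_re_le_norm ((x : ℂ) - z)
  have h2 := Complex.abs_im_le_norm ((x : ℂ) - z)
  simp only [Complex.sub_re, Complex.ofReal_re, Complex.sub_im, Complex.ofReal_im, zero_sub,
    abs_neg] at h1 h2
  have h0 : 0 ≤ ‖(x : ℂ) - z‖ := norm_nonneg _
  -- Either the real parts differ by at least `x/2`, or `|Im z| ≥ x/(2M)`.
  rcases le_total z.re (x / 2) with h | h
  · have := le_abs_self (x - z.re)
    nlinarith
  · nlinarith

lemma norm_le_norm_ofReal_sub {M x : ℝ} (hM : 1 ≤ M) (hx : 0 < x) {z : ℂ}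
    (hz : z.re ≤ M * |z.im|) : ‖z‖ ≤ 3 * M * ‖(x : ℂ) - z‖ := by
  have h1 := le_norm_ofReal_sub (x := x) hM hz
  have h2 : ‖z‖ ≤ ‖(x : ℂ)‖ + ‖(x : ℂ) - z‖ := by
    simpa using norm_sub_le (x : ℂ) ((x : ℂ) - z)
  rw [Complex.norm_of_nonneg hx.le] at h2
  nlinarith [norm_nonneg ((x : ℂ) - z)]

/-- Multiplicative second differences of `x ↦ x / (x - z)`. -/
lemma norm_second_difference_le {M x a : ℝ} (hM : 1 ≤ M) (hx : 0 < x) (ha : 1 ≤ a) {z : ℂ}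
    (hz : z.re ≤ M * |z.im|) :
    ‖((a * x : ℝ) : ℂ) * (1 / (((a * x : ℝ) : ℂ) - z))
      + ((x / a : ℝ) : ℂ) * (1 / (((x / a : ℝ) : ℂ) - z))
      - 2 * ((x : ℂ) * (1 / ((x : ℂ) - z)))‖ ≤ 30 * M ^ 3 * (a - 1) ^ 2 := by
  have ha0 : 0 < a := by linarith
  have hax : 0 < a * x := by positivity
  have hxa : 0 < x / a := by positivity
  have n0 : 0 < ‖(x : ℂ) - z‖ := by
    have := le_norm_ofReal_sub (x := x) hM hz
    by_contra! h
    nlinarith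
  have n1 : 0 < ‖((a * x : ℝ) : ℂ) - z‖ := by
    have := le_norm_ofReal_sub (x := a * x) hM hz
    by_contra! h
    nlinarith
  have n2 : 0 < ‖((x / a : ℝ) : ℂ) - z‖ := by
    have := le_norm_ofReal_sub (x := x / a) hM hz
    by_contra! h
    nlinarith
  have e0 : (x : ℂ) - z ≠ 0 := norm_pos_iff.1 n0
  have e1 : ((a * x : ℝ) : ℂ) - z ≠ 0 := norm_pos_iff.1 n1
  have e2 : ((x / a : ℝ) : ℂ) - z ≠ 0 := norm_pos_iff.1 n2
  have ea : (a : ℂ) ≠ 0 := by exact_mod_cast ha0.ne'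
  have key : ((a * x : ℝ) : ℂ) * (1 / (((a * x : ℝ) : ℂ) - z))
      + ((x / a : ℝ) : ℂ) * (1 / (((x / a : ℝ) : ℂ) - z))
      - 2 * ((x : ℂ) * (1 / ((x : ℂ) - z))) =
      ((x / a : ℝ) : ℂ) * z * ((x : ℂ) + z) * ((a : ℂ) - 1) ^ 2 /
        (((x : ℂ) - z) * (((a * x : ℝ) : ℂ) - z) * (((x / a : ℝ) : ℂ) - z)) := by
    have hx' : (x : ℂ) = ((x / a : ℝ) : ℂ) * a := by
      push_cast
      field_simp
    have hax' : ((a * x : ℝ) : ℂ) = ((x / a : ℝ) : ℂ) * a ^ 2 := by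
      push_cast
      field_simp
    rw [hax'] at e1 ⊢
    rw [hx'] at e0
    rw [hx']
    generalize ((x / a : ℝ) : ℂ) = w at *
    field_simp
    ring
  rw [key, norm_div, div_le_iff₀ (by simp only [norm_mul]; positivity)]
  simp only [norm_mul, norm_pow]
  have b1 := norm_le_norm_ofReal_sub hM hx hz
  have b2 := le_norm_ofReal_sub (x := x / a) hM hz
  have b3 : ‖(x : ℂ) + z‖ ≤ 5 * M * ‖((a * x : ℝ) : ℂ) - z‖ := by
    have h1 := norm_le_norm_ofReal_sub hM hax hz
    have h2 := le_norm_ofReal_sub (x := a * x) hM hz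
    have h3 := norm_add_le (x : ℂ) z
    rw [Complex.norm_of_nonneg hx.le] at h3
    nlinarith
  have b4 : ‖(a : ℂ) - 1‖ = a - 1 := by
    rw [← Complex.ofReal_one, ← Complex.ofReal_sub, Complex.norm_of_nonneg (by linarith)]
  rw [Complex.norm_of_nonneg hxa.le, b4]
  -- Each numerator factor is absorbed by a different denominator factor; `2 * 3 * 5` gives the
  -- constant 30.
  calc x / a * ‖z‖ * ‖(x : ℂ) + z‖ * (a - 1) ^ 2
      ≤ (2 * M * ‖((x / a : ℝ) : ℂ) - z‖) * (3 * M * ‖(x : ℂ) - z‖)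
        * (5 * M * ‖((a * x : ℝ) : ℂ) - z‖) * (a - 1) ^ 2 := by gcongr
    _ = _ := by ring

/-- If all complex roots of a real polynomial avoid a sector around the positive axis, then
`x ↦ x * p'(x) / p(x)` has small multiplicative second differences. -/
lemma abs_second_difference_logDeriv_le {M x a : ℝ} (hM : 1 ≤ M) (hx : 0 < x) (ha : 1 ≤ a)
    {p : ℝ[X]} (hp : ∀ y : ℝ, 0 < y → p.eval y ≠ 0)
    (hz : ∀ z : ℂ, p.aeval z = 0 → z.re ≤ M * |z.im|) :
    |a * x * (p.derivative.eval (a * x) / p.eval (a * x))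
      + x / a * (p.derivative.eval (x / a) / p.eval (x / a))
      - 2 * (x * (p.derivative.eval x / p.eval x))| ≤ p.natDegree * (30 * M ^ 3 * (a - 1) ^ 2) := by
  set P : ℂ[X] := p.map (algebraMap ℝ ℂ) with hP
  have ha0 : 0 < a := by linarith
  have ev : ∀ (q : ℝ[X]) (y : ℝ), (q.map (algebraMap ℝ ℂ)).eval (y : ℂ) = ((q.eval y : ℝ) : ℂ) := by
    intro q y
    rw [← Complex.coe_algebraMap, eval_map_algebraMap, aeval_algebraMap_apply]
    simp
  have hg : ∀ y : ℝ, 0 < y → ((p.derivative.eval y / p.eval y : ℝ) : ℂ)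
      = (P.roots.map fun z ↦ 1 / ((y : ℂ) - z)).sum := by
    intro y hy
    rw [← (IsAlgClosed.splits P).eval_derivative_div_eval_of_ne_zero, hP, derivative_map, ev, ev]
    · push_cast; rfl
    · rw [ev]
      exact_mod_cast hp y hy
  have hnorm : ∀ y : ℝ, |y| = ‖(y : ℂ)‖ := fun y => (Complex.norm_real y).symm
  rw [hnorm, Complex.ofReal_sub, Complex.ofReal_add, Complex.ofReal_mul (a * x),
    Complex.ofReal_mul (x / a), Complex.ofReal_mul 2, Complex.ofReal_mul x, hg _ hx,
    hg _ (mul_pos ha0 hx), hg _ (div_pos hx ha0), Complex.ofReal_ofNat]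
  rw [← Multiset.sum_map_mul_left, ← Multiset.sum_map_mul_left, ← Multiset.sum_map_mul_left,
    ← Multiset.sum_map_mul_left, ← Multiset.sum_map_add, ← Multiset.sum_map_sub]
  refine (norm_multiset_sum_le _).trans ?_
  rw [Multiset.map_map]
  have hcard : (Multiset.card P.roots : ℝ) ≤ p.natDegree := by
    have := P.card_roots'
    rw [hP, natDegree_map] at this
    exact_mod_cast this
  have hbound : ∀ y ∈ P.roots.map (norm ∘ fun z => ((a * x : ℝ) : ℂ) * (1 / (((a * x : ℝ) : ℂ) - z))
      + ((x / a : ℝ) : ℂ) * (1 / (((x / a : ℝ) : ℂ) - z))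
      - 2 * ((x : ℂ) * (1 / ((x : ℂ) - z)))), y ≤ 30 * M ^ 3 * (a - 1) ^ 2 := by
    intro y hy
    obtain ⟨z, hzP, rfl⟩ := Multiset.mem_map.1 hy
    refine norm_second_difference_le hM hx ha (hz z ?_)
    have := (mem_roots'.1 hzP).2
    rwa [IsRoot.def, hP, eval_map_algebraMap] at this
  refine (Multiset.sum_le_card_nsmul _ _ hbound).trans ?_
  rw [Multiset.card_map, nsmul_eq_mul]
  gcongr

/-! ### Truncated binomials -/

/-- The truncation of `(1 + X) ^ n` at degree `k`. -/
noncomputable def truncBinom (n k : ℕ) : ℝ[X] :=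
  ∑ i ∈ Finset.range (k + 1), C (n.choose i : ℝ) * X ^ i

lemma eval_truncBinom (n k : ℕ) (x : ℝ) :
    (truncBinom n k).eval x = ∑ i ∈ Finset.range (k + 1), (n.choose i : ℝ) * x ^ i := by
  simp [truncBinom, eval_finsetSum]

lemma eval_truncBinom_pos (n k : ℕ) {x : ℝ} (hx : 0 < x) : 0 < (truncBinom n k).eval x := by
  rw [eval_truncBinom, Finset.sum_range_succ']
  have : 0 ≤ ∑ i ∈ Finset.range k, (n.choose (i + 1) : ℝ) * x ^ (i + 1) :=
    Finset.sum_nonneg fun _ _ => by positivity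
  simp only [Nat.choose_zero_right, Nat.cast_one, pow_zero, mul_one]
  linarith

lemma natDegree_truncBinom_le (n k : ℕ) : (truncBinom n k).natDegree ≤ k :=
  natDegree_sum_le_of_forall_le _ _ fun _ hi =>
    (natDegree_C_mul_X_pow_le _ _).trans (Nat.lt_succ_iff.1 (Finset.mem_range.1 hi))

lemma choose_succ_mul {n i : ℕ} (hi : i ≤ n) :
    (n.choose (i + 1) : ℝ) * (i + 1) = n.choose i * (n - i) := by
  have := Nat.choose_succ_right_eq n i
  have h : ((n - i : ℕ) : ℝ) = n - i := Nat.cast_sub hi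
  rw [← h]
  exact_mod_cast this

/-- The full `(1+x)^n` satisfies `(1+x)p' = np`; truncation leaves only a boundary term, so `g` is
controlled by the ratio of the last term to `p`. -/
lemma one_add_mul_derivative_truncBinom {n k : ℕ} (hk : k ≤ n) (x : ℝ) :
    (1 + x) * (truncBinom n k).derivative.eval x
      = n * (truncBinom n k).eval x - (n - k) * (n.choose k * x ^ k) := by
  induction k with
  | zero => simp [truncBinom]
  | succ k ih =>
    have h1 : truncBinom n (k + 1) = truncBinom n k + C (n.choose (k + 1) : ℝ) * X ^ (k + 1) := by
      rw [truncBinom, Finset.sum_range_succ, truncBinom]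
    have h2 := choose_succ_mul (Nat.le_of_succ_le hk)
    rw [h1]
    simp only [derivative_add, derivative_C_mul_X_pow, eval_add, eval_mul, eval_C, eval_pow, eval_X,
      mul_add, ih (Nat.le_of_succ_le hk), Nat.add_sub_cancel]
    push_cast
    linear_combination x ^ k * h2

lemma mul_derivative_truncBinom_le (n k : ℕ) {x : ℝ} (hx : 0 ≤ x) :
    x * (truncBinom n k).derivative.eval x ≤ k * (truncBinom n k).eval x := by
  rw [eval_truncBinom, truncBinom, derivative_sum, eval_finsetSum, Finset.mul_sum, Finset.mul_sum]
  refine Finset.sum_le_sum fun i hi => ?_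
  have hik : (i : ℝ) ≤ k := by exact_mod_cast Nat.lt_succ_iff.1 (Finset.mem_range.1 hi)
  simp only [derivative_C_mul_X_pow, eval_mul, eval_C, eval_pow, eval_X]
  rcases i with _ | i
  · simp
  · rw [Nat.add_sub_cancel]
    calc _ = ((i + 1 : ℕ) : ℝ) * ((n.choose (i + 1) : ℝ) * x ^ (i + 1)) := by ring
      _ ≤ _ := by gcongr

/-- At `x = k / (n - k)` the last terms of the truncated binomial series are almost equal. -/
lemma last_terms_truncBinom {n k J : ℕ} (hk : 0 < k) (hn : 2 * k ≤ n) (hJ : J ≤ k) {j : ℕ}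
    (hj : j ≤ J) {x : ℝ} (hx : x = k / (n - k)) :
    (1 - 2 * J * j / k) * (n.choose k * x ^ k) ≤ n.choose (k - j) * x ^ (k - j) := by
  have hk' : (0 : ℝ) < k := by exact_mod_cast hk
  have hn' : (2 : ℝ) * k ≤ n := by exact_mod_cast hn
  have hx0 : 0 < x := by rw [hx]; apply div_pos <;> linarith
  have hxk : x * (n - k) = k := by rw [hx]; field_simp [show (n : ℝ) - k ≠ 0 by linarith]
  induction j with
  | zero => simp
  | succ j ih =>
    have ih := ih (Nat.le_of_succ_le hj)
    obtain ⟨i, hi⟩ : ∃ i, k = i + 1 + j := ⟨k - (j + 1), by omega⟩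
    have e1 : k - j = i + 1 := by omega
    have e2 : k - (j + 1) = i := by omega
    rw [e1] at ih
    rw [e2]
    have hc := choose_succ_mul (n := n) (i := i) (by omega)
    have hki : (k : ℝ) = i + 1 + j := by exact_mod_cast hi
    set A : ℝ := n.choose i * x ^ i with hA
    set B : ℝ := n.choose (i + 1) * x ^ (i + 1) with hB
    set L : ℝ := n.choose k * x ^ k with hL
    have hA0 : 0 ≤ A := by positivity
    have hB0 : 0 ≤ B := by positivity
    have hL0 : 0 ≤ L := by positivity
    have hjJ : (j : ℝ) + 1 ≤ J := by exact_mod_cast hj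
    have hj0 : (0 : ℝ) ≤ j := Nat.cast_nonneg j
    have hBA : (k - j) * (n - k) * B = (n - k + j + 1) * k * A := by
      have h3 : B * (i + 1) = x * (n - i) * A := by
        rw [hA, hB]
        linear_combination x ^ (i + 1) * hc
      have h4 : (i : ℝ) = k - j - 1 := by linarith
      rw [h4] at h3
      linear_combination (n - k) * h3 + (n - (k - j - 1)) * A * hxk
    have hN : 0 < (n : ℝ) - k + j + 1 := by linarith
    -- The ratio of consecutive terms is at least `1 - (2j+1)/k`, by `n ≥ 2k`, hence at least `1 -
    -- 2J/k`. The induction is then Bernoulli's inequality.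
    have h5 : (k - 2 * J) * B ≤ k * A := by
      refine le_of_mul_le_mul_left ?_ hN
      have h6 : (n - k + j + 1) * (k - (2 * j + 1)) * B ≤ (n - k + j + 1) * k * A := by
        rw [← hBA]
        refine mul_le_mul_of_nonneg_right ?_ hB0
        nlinarith
      have h7 : (n - k + j + 1) * (k - 2 * J) * B ≤ (n - k + j + 1) * (k - (2 * j + 1)) * B := by
        refine mul_le_mul_of_nonneg_right (mul_le_mul_of_nonneg_left ?_ hN.le) hB0
        linarith
      linarith
    have h8 : (1 - 2 * J / k) * B ≤ A := by
      refine le_of_mul_le_mul_left ?_ hk'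
      calc k * ((1 - 2 * J / k) * B) = (k - 2 * J) * B := by field_simp
        _ ≤ _ := h5
    set q : ℝ := 2 * J / k with hq
    have hq0 : 0 ≤ q := by positivity
    have e3 : 2 * (J : ℝ) * (j + 1 : ℕ) / k = q * (j + 1) := by rw [hq]; push_cast; ring
    have e4 : 2 * (J : ℝ) * j / k = q * j := by rw [hq]; ring
    rw [e3]
    rw [e4] at ih
    rcases le_total q 1 with h | h
    · have : (1 - q) * ((1 - q * j) * L) ≤ (1 - q) * B :=
        mul_le_mul_of_nonneg_left ih (by linarith)
      nlinarith [mul_nonneg (mul_nonneg (mul_nonneg hq0 hq0) hj0) hL0]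
    · have : (1 - q * (j + 1)) * L ≤ 0 := mul_nonpos_of_nonpos_of_nonneg (by nlinarith) hL0
      linarith

/-- The last `J` terms are each at least half of the final one, because `2J²/k ≤ 1/2`; so the final
term is a small fraction of the sum. -/
lemma last_term_truncBinom_le {n k J : ℕ} (hJ : 0 < J) (hk : 4 * J ^ 2 ≤ k) (hn : 2 * k ≤ n)
    {x : ℝ} (hx : x = k / (n - k)) :
    J * (n.choose k * x ^ k) ≤ 2 * (truncBinom n k).eval x := by
  have hJk : J ≤ k := by nlinarith
  have hk0 : 0 < k := by omega
  have hk' : (0 : ℝ) < k := by exact_mod_cast hk0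
  have hn' : (2 : ℝ) * k ≤ n := by exact_mod_cast hn
  have hx0 : 0 < x := by rw [hx]; apply div_pos <;> linarith
  have hL0 : 0 ≤ (n.choose k : ℝ) * x ^ k := by positivity
  have h1 : ∑ _j ∈ Finset.range J, (1 / 2 : ℝ) * (n.choose k * x ^ k)
      ≤ ∑ j ∈ Finset.range J, (n.choose (k - j) : ℝ) * x ^ (k - j) := by
    refine Finset.sum_le_sum fun j hj => ?_
    have hj := (Finset.mem_range.1 hj).le
    refine le_trans (mul_le_mul_of_nonneg_right ?_ hL0) (last_terms_truncBinom hk0 hn hJk hj hx)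
    have : 2 * (J : ℝ) * j / k ≤ 1 / 2 := by
      rw [div_le_iff₀ hk']
      have a1 : (j : ℝ) ≤ J := by exact_mod_cast hj
      have a2 : 4 * (J : ℝ) ^ 2 ≤ k := by exact_mod_cast hk
      nlinarith [Nat.cast_nonneg (α := ℝ) J]
    linarith
  have h2 : ∑ j ∈ Finset.range J, (n.choose (k - j) : ℝ) * x ^ (k - j)
      ≤ ∑ j ∈ Finset.range (k + 1), (n.choose (k - j) : ℝ) * x ^ (k - j) :=
    Finset.sum_le_sum_of_subset_of_nonneg (Finset.range_mono (by omega))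
      fun _ _ _ => by positivity
  have h3 := Finset.sum_range_reflect (fun i => (n.choose i : ℝ) * x ^ i) (k + 1)
  simp only [Nat.add_sub_cancel] at h3
  rw [h3, ← eval_truncBinom] at h2
  rw [Finset.sum_const, Finset.card_range, nsmul_eq_mul] at h1
  linarith

/-- Truncated binomial polynomials have roots arbitrarily close to the positive axis. -/
theorem exists_root_truncBinom (M : ℝ) : ∃ k : ℕ, 0 < k ∧ ∀ n : ℕ, 2 * k ≤ n →
    ∃ z : ℂ, 0 < z.im ∧ M * z.im ≤ z.re ∧ (truncBinom n k).aeval z = 0 := by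
  wlog hM : 1 ≤ M generalizing M
  · obtain ⟨k, hk, h⟩ := this 1 le_rfl
    refine ⟨k, hk, fun n hn => ?_⟩
    obtain ⟨z, h1, h2, h3⟩ := h n hn
    exact ⟨z, h1, by nlinarith, h3⟩
  set c : ℝ := 30 * M ^ 3 with hc
  have hc1 : 1 ≤ c := by
    have : 1 ≤ M ^ 3 := one_le_pow₀ hM
    linarith
  -- This makes the error `4/J` smaller than the gap `1/(36c)` found at the end.
  obtain ⟨J, hJ⟩ := exists_nat_gt (144 * c)
  have hJ0 : (0 : ℝ) < J := by linarith
  have hJ0' : 0 < J := by exact_mod_cast hJ0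
  refine ⟨4 * J ^ 2, by positivity, fun n hn => ?_⟩
  set k : ℕ := 4 * J ^ 2 with hk
  have hk0 : 0 < k := by positivity
  by_contra! hroot
  set p := truncBinom n k with hp
  have hpos : ∀ y : ℝ, 0 < y → 0 < p.eval y := fun y hy => eval_truncBinom_pos n k hy
  -- Conjugation covers the lower half-plane; positive coefficients exclude positive real roots.
  have hsec : ∀ z : ℂ, p.aeval z = 0 → z.re ≤ M * |z.im| := by
    intro z hz
    rcases lt_trichotomy z.im 0 with h | h | h
    · by_contra! hlt
      refine hroot (starRingEnd ℂ z) (by simpa using h) ?_ ?_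
      · rw [abs_of_neg h] at hlt
        simpa using hlt.le
      · rw [aeval_conj, hz, map_zero]
    · by_contra! hlt
      rw [h] at hlt
      simp only [abs_zero, mul_zero] at hlt
      have hzr : z = ((z.re : ℝ) : ℂ) := Complex.ext rfl (by simpa using h)
      rw [hzr, ← Complex.coe_algebraMap, aeval_algebraMap_apply] at hz
      simp only [coe_aeval_eq_eval, Complex.coe_algebraMap, Complex.ofReal_eq_zero] at hz
      exact (hpos _ hlt).ne' hz
    · by_contra! hlt
      rw [abs_of_pos h] at hlt
      exact hroot z h hlt.le hz
  have hk' : (0 : ℝ) < k := by exact_mod_cast hk0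
  have hn' : (2 : ℝ) * k ≤ n := by exact_mod_cast hn
  have hnk : (0 : ℝ) < n - k := by linarith
  have hn0 : (0 : ℝ) < n := by linarith
  set x : ℝ := k / (n - k) with hx
  have hx0 : 0 < x := div_pos hk' hnk
  -- This `a - 1` maximizes `(a-1)/3 - c(a-1)²`, the linear kink minus the quadratic bound.
  set a : ℝ := 1 + 1 / (6 * c) with ha
  have ha1 : 1 ≤ a := by
    have : 0 ≤ 1 / (6 * c) := by positivity
    linarith
  have ha2 : a ≤ 2 := by
    have : 1 / (6 * c) ≤ 1 := by rw [div_le_one (by positivity)]; linarith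
    linarith
  have ha0 : 0 < a := by linarith
  have main := abs_second_difference_logDeriv_le hM hx0 ha1 (fun y hy => (hpos y hy).ne') hsec
  rw [← hc] at main
  have hdeg : (p.natDegree : ℝ) * (c * (a - 1) ^ 2) ≤ k * (c * (a - 1) ^ 2) := by
    have : (p.natDegree : ℝ) ≤ k := by exact_mod_cast natDegree_truncBinom_le n k
    gcongr
  have ode := fun y => one_add_mul_derivative_truncBinom (n := n) (k := k) (by omega) y
  rw [← hp] at ode
  have g1 : a * x * (p.derivative.eval (a * x) / p.eval (a * x)) ≤ k := by
    rw [← mul_div_assoc, div_le_iff₀ (hpos _ (by positivity))]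
    exact mul_derivative_truncBinom_le n k (by positivity)
  have g2 : x / a * (p.derivative.eval (x / a) / p.eval (x / a)) ≤ 2 * k / (1 + a) := by
    have hy : 0 < x / a := by positivity
    have h1 : (1 + x / a) * p.derivative.eval (x / a) ≤ n * p.eval (x / a) := by
      rw [ode]
      have : 0 ≤ ((n : ℝ) - k) * (n.choose k * (x / a) ^ k) := by positivity
      linarith
    -- After clearing denominators this is `(a-1)(n-2k) ≥ 0`.
    have h2 : x / a * n * (1 + a) ≤ 2 * k * (1 + x / a) := by
      have e : x / a = k / (a * (n - k)) := by rw [hx]; field_simp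
      rw [e]
      have : (k : ℝ) * n * (1 + a) ≤ 2 * k * (a * (n - k) + k) := by
        nlinarith [mul_nonneg (mul_nonneg hk'.le (sub_nonneg.2 ha1))
          (show (0 : ℝ) ≤ n - 2 * k by linarith)]
      have hd : 0 < a * (n - k) := by positivity
      rw [div_mul_eq_mul_div, div_mul_eq_mul_div, div_le_iff₀ hd]
      calc _ ≤ _ := this
        _ = _ := by field_simp
    rw [← mul_div_assoc, div_le_div_iff₀ (hpos _ hy) (by positivity)]
    have hq := (hpos _ hy).le
    refine le_of_mul_le_mul_left ?_ (show 0 < 1 + x / a by positivity)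
    calc (1 + x / a) * (x / a * p.derivative.eval (x / a) * (1 + a))
        = ((1 + x / a) * p.derivative.eval (x / a)) * (x / a * (1 + a)) := by ring
      _ ≤ (n * p.eval (x / a)) * (x / a * (1 + a)) := by gcongr
      _ = (x / a * n * (1 + a)) * p.eval (x / a) := by ring
      _ ≤ (2 * k * (1 + x / a)) * p.eval (x / a) := by gcongr
      _ = _ := by ring
  have g3 : k * (1 - 2 / J) ≤ x * (p.derivative.eval x / p.eval x) := by
    have hlast := last_term_truncBinom_le hJ0' (le_refl k) hn hx
    rw [← hp] at hlast
    have h1 := ode x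
    have hB : 0 ≤ (n.choose k : ℝ) * x ^ k := by positivity
    generalize (n.choose k : ℝ) * x ^ k = B at *
    have hxk : x * (n - k) = k := by rw [hx]; field_simp
    have h2 : n * (x * p.derivative.eval x) = k * (n * p.eval x - (n - k) * B) := by
      rw [← h1]
      linear_combination p.derivative.eval x * hxk
    have h3 : k * (p.eval x - B) ≤ x * p.derivative.eval x := by
      refine le_of_mul_le_mul_left ?_ hn0
      rw [h2]
      nlinarith [mul_nonneg (mul_nonneg hk'.le hk'.le) hB]
    have h4 : B ≤ 2 / J * p.eval x := by
      rw [div_mul_eq_mul_div, le_div_iff₀ hJ0]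
      linarith
    rw [← mul_div_assoc, le_div_iff₀ (hpos x hx0)]
    nlinarith
  have h5 := (neg_le_abs _).trans (main.trans hdeg)
  have h6 : k * (1 - 4 / J - 2 / (1 + a)) ≤ k * (c * (a - 1) ^ 2) := by
    have : k * (1 - 4 / J - 2 / (1 + a)) = 2 * (k * (1 - 2 / J)) - k - 2 * k / (1 + a) := by ring
    rw [this]
    linarith
  have h7 := le_of_mul_le_mul_left h6 hk'
  have h8 : (a - 1) / 3 ≤ 1 - 2 / (1 + a) := by
    have : 1 - 2 / (1 + a) = (a - 1) / (1 + a) := by field_simp; ring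
    rw [this]
    exact div_le_div_of_nonneg_left (by linarith) (by linarith) (by linarith)
  have e1 : a - 1 = 1 / (6 * c) := by rw [ha]; ring
  have h9 : 4 / (J : ℝ) < 1 / (36 * c) := by
    rw [div_lt_div_iff₀ hJ0 (by positivity)]
    linarith
  have h10 : (a - 1) / 3 - c * (a - 1) ^ 2 = 1 / (36 * c) := by
    rw [e1]
    field_simp
    norm_num
  linarith

/-! ### Prisms, their Minkowski sums and volumes -/

/-- Boxes with affinely varying side lengths over an interval. -/
def prismSet {N : ℕ} (h : ℝ) (a b : Fin N → ℝ) : Set (EuclideanSpace ℝ (Fin (N + 1))) :=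
  {v | (0 ≤ v 0 ∧ v 0 ≤ h) ∧ ∀ i : Fin N, 0 ≤ v i.succ ∧ v i.succ ≤ a i + b i * v 0}

lemma convex_prismSet {N : ℕ} (h : ℝ) (a b : Fin N → ℝ) : Convex ℝ (prismSet h a b) := by
  intro x hx y hy p q hp hq hpq
  simp only [prismSet, Set.mem_ofPred_eq, PiLp.add_apply, PiLp.smul_apply, smul_eq_mul] at *
  refine ⟨⟨add_nonneg (mul_nonneg hp hx.1.1) (mul_nonneg hq hy.1.1), ?_⟩, fun i =>
    ⟨add_nonneg (mul_nonneg hp (hx.2 i).1) (mul_nonneg hq (hy.2 i).1), ?_⟩⟩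
  · have h1 := mul_le_mul_of_nonneg_left hx.1.2 hp
    have h2 := mul_le_mul_of_nonneg_left hy.1.2 hq
    calc _ ≤ p * h + q * h := add_le_add h1 h2
      _ = h := by rw [← add_mul, hpq, one_mul]
  · have h1 := mul_le_mul_of_nonneg_left (hx.2 i).2 hp
    have h2 := mul_le_mul_of_nonneg_left (hy.2 i).2 hq
    calc _ ≤ p * (a i + b i * x 0) + q * (a i + b i * y 0) := add_le_add h1 h2
      _ = (p + q) * a i + b i * (p * x 0 + q * y 0) := by ring
      _ = _ := by rw [hpq, one_mul]

lemma isClosed_prismSet {N : ℕ} (h : ℝ) (a b : Fin N → ℝ) : IsClosed (prismSet h a b) := by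
  simp only [prismSet, Set.ofPred_and, Set.ofPred_forall]
  refine ((isClosed_le (by fun_prop) (by fun_prop)).inter
    (isClosed_le (by fun_prop) (by fun_prop))).inter (isClosed_iInter fun i =>
    (isClosed_le (by fun_prop) (by fun_prop)).inter (isClosed_le (by fun_prop) (by fun_prop)))

lemma isCompact_prismSet {N : ℕ} (h : ℝ) (a b : Fin N → ℝ) : IsCompact (prismSet h a b) := by
  let e := (EuclideanSpace.equiv (Fin (N + 1)) ℝ).toHomeomorph
  have hc : IsCompact (e ⁻¹' Set.Icc 0 (Fin.cons h fun i => a i + |b i| * h)) :=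
    e.isCompact_preimage.2 isCompact_Icc
  refine hc.of_isClosed_subset (isClosed_prismSet h a b) fun v hv => ?_
  have hv0 := hv.1
  refine ⟨fun i => ?_, fun i => ?_⟩
  · refine Fin.cases hv.1.1 (fun j => (hv.2 j).1) i
  · refine Fin.cases hv.1.2 (fun j => (hv.2 j).2.trans ?_) i
    simp only [Fin.cons_succ]
    have := mul_le_mul (le_abs_self (b j)) hv0.2 hv0.1 (abs_nonneg _)
    linarith

/-- The convex body with underlying set `prismSet h a b`. -/
def prism {N : ℕ} {h : ℝ} {a : Fin N → ℝ} (b : Fin N → ℝ) (hh : 0 ≤ h) (ha : ∀ i, 0 ≤ a i) :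
    Body (N + 1) where
  carrier := prismSet h a b
  convex' := convex_prismSet h a b
  isCompact' := isCompact_prismSet h a b
  nonempty' := ⟨0, by simpa [prismSet] using ⟨hh, ha⟩⟩

/-- The second body has height 0, so the sum is taken fibre by fibre, where boxes add their side
lengths. -/
lemma prismSet_add_smul {N : ℕ} {a b g : Fin N → ℝ} {t : ℝ} (ht : 0 ≤ t)
    (hab : ∀ u ∈ Set.Icc (0 : ℝ) 1, ∀ i, 0 ≤ a i + b i * u) (hg : ∀ i, 0 ≤ g i) :
    prismSet 1 a b + t • prismSet 0 g 0 = prismSet 1 (fun i => a i + t * g i) b := by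
  ext w
  constructor
  · rintro ⟨x, hx, _, ⟨y, hy, rfl⟩, rfl⟩
    simp only [prismSet, Set.mem_ofPred_eq, PiLp.add_apply, PiLp.smul_apply, smul_eq_mul,
      Pi.zero_apply, zero_mul, add_zero] at *
    have hy0 : y 0 = 0 := le_antisymm hy.1.2 hy.1.1
    rw [hy0, mul_zero, add_zero]
    refine ⟨hx.1, fun i => ⟨add_nonneg (hx.2 i).1 (mul_nonneg ht (hy.2 i).1), ?_⟩⟩
    have := mul_le_mul_of_nonneg_left (hy.2 i).2 ht
    linarith [(hx.2 i).2]
  · intro hw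
    have hw0 := hab (w 0) hw.1
    -- At `t = 0` the division is by zero, but then the excess is zero as well.
    have hdiv : ∀ i : Fin N, t * (max (w i.succ - (a i + b i * w 0)) 0 / t)
        = max (w i.succ - (a i + b i * w 0)) 0 := by
      intro i
      rcases ht.eq_or_lt with h | h
      · have := (hw.2 i).2
        simp only [← h, zero_mul, add_zero] at this
        rw [max_eq_right (by linarith)]
        simp
      · field_simp
    -- Cut each coordinate at the side length of the first box and give the excess to the second
    -- body.
    refine ⟨WithLp.toLp 2 (Fin.cons (w 0) fun i => min (w i.succ) (a i + b i * w 0)), ?_,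
      t • WithLp.toLp 2 (Fin.cons 0 fun i => max (w i.succ - (a i + b i * w 0)) 0 / t),
      Set.smul_mem_smul_set ?_, ?_⟩
    · refine ⟨hw.1, fun i => ⟨?_, ?_⟩⟩
      · simpa using ⟨(hw.2 i).1, hw0 i⟩
      · simp
    · refine ⟨by simp, fun i => ⟨?_, ?_⟩⟩
      · simp only [Fin.cons_succ]
        positivity
      · simp only [Fin.cons_succ, Pi.zero_apply, zero_mul, add_zero]
        refine div_le_of_le_mul₀ ht (hg i) (max_le ?_ (mul_nonneg (hg i) ht))
        linarith [(hw.2 i).2]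
    · ext i
      refine Fin.cases ?_ (fun j => ?_) i
      · simp
      · simp only [PiLp.add_apply, PiLp.smul_apply, Fin.cons_succ, smul_eq_mul, hdiv]
        rcases le_total (w j.succ) (a j + b j * w 0) with h | h
        · rw [min_eq_left h, max_eq_right (by linarith)]; ring
        · rw [min_eq_right h, max_eq_left (by linarith)]; ring

lemma volume_real_prismSet {N : ℕ} {a b : Fin N → ℝ}
    (hab : ∀ u ∈ Set.Icc (0 : ℝ) 1, ∀ i, 0 ≤ a i + b i * u) :
    (volume : Measure (EuclideanSpace ℝ (Fin (N + 1)))).real (prismSet 1 a b)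
      = ∫ u in (0 : ℝ)..1, ∏ i, (a i + b i * u) := by
  let T : Set (ℝ × (Fin N → ℝ)) :=
    {q | (0 ≤ q.1 ∧ q.1 ≤ 1) ∧ ∀ i, 0 ≤ q.2 i ∧ q.2 i ≤ a i + b i * q.1}
  have hT : MeasurableSet T := by
    refine IsClosed.measurableSet ?_
    simp only [T, Set.ofPred_and, Set.ofPred_forall]
    refine ((isClosed_le (by fun_prop) (by fun_prop)).inter
      (isClosed_le (by fun_prop) (by fun_prop))).inter (isClosed_iInter fun i =>
      (isClosed_le (by fun_prop) (by fun_prop)).inter (isClosed_le (by fun_prop) (by fun_prop)))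
  have hmp := (volume_preserving_piFinSuccAbove (fun _ : Fin (N + 1) => ℝ) 0).comp
    (PiLp.volume_preserving_ofLp (Fin (N + 1)))
  have hpre : prismSet 1 a b = (MeasurableEquiv.piFinSuccAbove (fun _ : Fin (N + 1) => ℝ) 0 ∘
      @WithLp.ofLp 2 (Fin (N + 1) → ℝ)) ⁻¹' T := by
    ext v
    simp [prismSet, T, Fin.tail]
  have hfib : ∀ u : ℝ, volume (Prod.mk u ⁻¹' T)
      = (Set.Icc (0 : ℝ) 1).indicator (fun u => ENNReal.ofReal (∏ i, (a i + b i * u))) u := by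
    intro u
    by_cases hu : u ∈ Set.Icc (0 : ℝ) 1
    · have : Prod.mk u ⁻¹' T = Set.Icc 0 (fun i => a i + b i * u) := by
        ext v
        simp only [T, Set.mem_preimage, Set.mem_ofPred_eq, Set.mem_Icc, Pi.le_def, Pi.zero_apply,
          forall_and]
        exact and_iff_right hu
      rw [this, Set.indicator_of_mem hu, Real.volume_Icc_pi,
        ENNReal.ofReal_prod_of_nonneg fun i _ => hab u hu i]
      simp
    · have : Prod.mk u ⁻¹' T = ∅ := by
        ext v
        simpa [T] using fun h1 h2 => (hu ⟨h1, h2⟩).elim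
      rw [this, Set.indicator_of_notMem hu, measure_empty]
  have hcont : Continuous fun u : ℝ => ∏ i, (a i + b i * u) := by fun_prop
  rw [Measure.real, hpre, hmp.measure_preimage hT.nullMeasurableSet, Measure.volume_eq_prod,
    Measure.prod_apply hT]
  simp_rw [hfib]
  rw [lintegral_indicator measurableSet_Icc, ← ofReal_integral_eq_lintegral_ofReal
    (hcont.continuousOn.integrableOn_Icc), ENNReal.toReal_ofReal,
    intervalIntegral.integral_of_le zero_le_one, integral_Icc_eq_integral_Ioc]
  · exact setIntegral_nonneg measurableSet_Icc fun u hu => Finset.prod_nonneg fun i _ => hab u hu i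
  · exact (ae_restrict_iff' measurableSet_Icc).2
      (.of_forall fun u hu => Finset.prod_nonneg fun i _ => hab u hu i)

/-! ### Beta integrals and the Steiner polynomial of the construction -/

lemma integral_pow_mul_one_sub_pow (l j : ℕ) :
    ∫ u in (0 : ℝ)..1, u ^ l * (1 - u) ^ j
      = (l.factorial * j.factorial : ℝ) / (l + j + 1).factorial := by
  induction j generalizing l with
  | zero =>
    simp [integral_pow, Nat.factorial_succ]
    field_simp
  | succ j ih =>
    have hd : ∀ u ∈ Set.uIcc (0 : ℝ) 1, HasDerivAt (fun u : ℝ => u ^ (l + 1) * (1 - u) ^ (j + 1))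
        ((l + 1) * (u ^ l * (1 - u) ^ (j + 1)) - (j + 1) * (u ^ (l + 1) * (1 - u) ^ j)) u := by
      intro u _
      have h1 := hasDerivAt_pow (l + 1) u
      have h2 := ((hasDerivAt_id u).const_sub 1).pow (j + 1)
      refine (h1.mul h2).congr_deriv ?_
      simp
      ring
    have hi := intervalIntegral.integral_eq_sub_of_hasDerivAt hd
      (Continuous.intervalIntegrable (by fun_prop) _ _)
    rw [intervalIntegral.integral_sub (Continuous.intervalIntegrable (by fun_prop) _ _)
      (Continuous.intervalIntegrable (by fun_prop) _ _), intervalIntegral.integral_const_mul,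
      intervalIntegral.integral_const_mul, ih] at hi
    simp only [sub_self, ne_eq, Nat.add_eq_zero_iff, one_ne_zero, and_false, not_false_eq_true,
      zero_pow, mul_zero, zero_mul] at hi
    have e : l + 1 + j + 1 = l + (j + 1) + 1 := by ring
    rw [e, Nat.factorial_succ l] at hi
    rw [Nat.factorial_succ j]
    push_cast at hi ⊢
    have hl : (l : ℝ) + 1 ≠ 0 := by positivity
    refine mul_left_cancel₀ hl ?_
    linear_combination hi

/-- The Beta integral of each binomial term replaces `k.choose i` by a constant multiple of
`(k+l+1).choose i`, which is how the truncation of a higher binomial arises. -/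
lemma integral_pow_mul_add_pow (k l : ℕ) (r c : ℝ) :
    ∫ u in (0 : ℝ)..1, (r + c * (1 - u)) ^ k * u ^ l
      = (k.factorial * l.factorial : ℝ) / (k + l + 1).factorial *
        ∑ i ∈ Finset.range (k + 1), ((k + l + 1).choose i : ℝ) * c ^ (k - i) * r ^ i := by
  have h : ∀ u : ℝ, (r + c * (1 - u)) ^ k * u ^ l = ∑ i ∈ Finset.range (k + 1),
      (r ^ i * c ^ (k - i) * k.choose i) * (u ^ l * (1 - u) ^ (k - i)) := by
    intro u
    rw [add_pow, Finset.sum_mul]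
    refine Finset.sum_congr rfl fun i _ => ?_
    rw [mul_pow]
    ring
  simp_rw [h]
  rw [intervalIntegral.integral_finsetSum fun i _ =>
    Continuous.intervalIntegrable (by fun_prop) _ _, Finset.mul_sum]
  refine Finset.sum_congr rfl fun i hi => ?_
  have hik : i ≤ k := Nat.lt_succ_iff.1 (Finset.mem_range.1 hi)
  rw [intervalIntegral.integral_const_mul, integral_pow_mul_one_sub_pow, Nat.cast_choose ℝ hik,
    Nat.cast_choose ℝ (show i ≤ k + l + 1 by omega),
    show k + l + 1 - i = l + (k - i) + 1 by omega]
  field_simp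

/-- The prism whose relative Steiner polynomial is a shifted, scaled truncated binomial. -/
def coneBody (k l : ℕ) {s c : ℝ} (hs : 0 ≤ s) (hc : 0 ≤ c) : Body (k + l + 1) :=
  prism (h := 1) (a := Fin.append (fun _ : Fin k => s + c) fun _ : Fin l => 0)
    (Fin.append (fun _ => -c) fun _ => 1) zero_le_one
    (Fin.addCases (by simpa using fun _ => add_nonneg hs hc) (by simp))

/-- A `k`-dimensional unit cube. -/
def flatCube (k l : ℕ) : Body (k + l + 1) :=
  prism (h := 0) (a := Fin.append (fun _ : Fin k => 1) fun _ : Fin l => 0) 0 le_rfl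
    (Fin.addCases (by simp) (by simp))

lemma volume_real_coneBody_add (k l : ℕ) {s c t : ℝ} (hs : 0 ≤ s) (hc : 0 ≤ c) (ht : 0 ≤ t) :
    (volume : Measure (EuclideanSpace ℝ (Fin (k + l + 1)))).real
        ((coneBody k l hs hc + t • flatCube k l : Body (k + l + 1)) :
          Set (EuclideanSpace ℝ (Fin (k + l + 1))))
      = (k.factorial * l.factorial : ℝ) / (k + l + 1).factorial *
        ∑ i ∈ Finset.range (k + 1), ((k + l + 1).choose i : ℝ) * c ^ (k - i) * (s + t) ^ i := by
  have hK : ((coneBody k l hs hc : Body (k + l + 1)) : Set (EuclideanSpace ℝ (Fin (k + l + 1)))) =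
    prismSet 1 (Fin.append (fun _ : Fin k => s + c) fun _ : Fin l => 0)
      (Fin.append (fun _ => -c) fun _ => 1) := rfl
  have hE : ((flatCube k l : Body (k + l + 1)) : Set (EuclideanSpace ℝ (Fin (k + l + 1)))) =
    prismSet 0 (Fin.append (fun _ : Fin k => 1) fun _ : Fin l => 0) 0 := rfl
  rw [ConvexBody.coe_add, ConvexBody.coe_smul, hK, hE, prismSet_add_smul ht,
    volume_real_prismSet, ← integral_pow_mul_add_pow]
  · refine intervalIntegral.integral_congr fun u _ => ?_
    simp only [Fin.prod_univ_add, Fin.append_left, Fin.append_right, Finset.prod_const,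
      Finset.card_univ, Fintype.card_fin]
    ring
  · intro u hu i
    refine Fin.addCases (fun j => ?_) (fun j => ?_) i
    · simp only [Fin.append_left]
      nlinarith [hu.1, hu.2]
    · simpa using hu.1
  · intro u hu i
    refine Fin.addCases (fun j => ?_) (fun j => ?_) i
    · simp only [Fin.append_left]
      nlinarith [hu.1, hu.2]
    · simpa using hu.1
  · exact Fin.addCases (by simp) (by simp)

/-- The Steiner formula in terms of a real polynomial. -/
lemma isSteinerPolynomial_map {n : ℕ} {K E : Body n} {P : ℝ[X]} (hdeg : P.natDegree ≤ n)
    (h : ∀ t : ℝ, 0 ≤ t → (volume : Measure (EuclideanSpace ℝ (Fin n))).real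
      ((K + t • E : Body n) : Set (EuclideanSpace ℝ (Fin n))) = P.eval t) :
    IsSteinerPolynomial K E (P.map (algebraMap ℝ ℂ)) := by
  have hch : ∀ i : Fin (n + 1), (n.choose i : ℝ) ≠ 0 := fun i => by
    exact_mod_cast (Nat.choose_pos (Nat.lt_succ_iff.mp i.2)).ne'
  refine ⟨fun i => P.coeff i / n.choose i, fun t ht => ?_, ?_⟩
  · rw [h t ht, eval_eq_sum_range' (Nat.lt_succ_of_le hdeg), ← Fin.sum_univ_eq_sum_range
      (fun i => P.coeff i * t ^ i)]
    refine Finset.sum_congr rfl fun i _ => ?_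
    rw [mul_div_cancel₀ _ (hch i)]
  · conv_lhs => rw [P.as_sum_range' (n + 1) (Nat.lt_succ_of_le hdeg)]
    rw [← Fin.sum_univ_eq_sum_range (fun i => monomial i (P.coeff i)), Polynomial.map_sum]
    refine Finset.sum_congr rfl fun i _ => ?_
    rw [map_monomial, ← C_mul_X_pow_eq_monomial]
    congr 2
    have := hch i
    push_cast
    rw [mul_div_cancel₀]
    · rfl
    · exact_mod_cast this

/-- Sets of positive volume are full-dimensional. -/
lemma dim_eq_of_volume_pos {n : ℕ} {K : Body n}
    (h : (volume : Measure (EuclideanSpace ℝ (Fin n))).real (K : Set _) ≠ 0) : dim K = n := by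
  have htop : affineSpan ℝ (K : Set (EuclideanSpace ℝ (Fin n))) = ⊤ := by
    by_contra hne
    apply h
    rw [Measure.real, measure_mono_null (subset_affineSpan ℝ _)
      (Measure.addHaar_affineSubspace volume _ hne), ENNReal.toReal_zero]
  rw [dim, ← direction_affineSpan, htop, AffineSubspace.direction_top, finrank_top,
    finrank_euclideanSpace_fin]

/-- The truncated binomials, shifted and scaled, are relative Steiner polynomials. -/
lemma mem_rootCone_of_sum_eq_zero {k l : ℕ} {s c : ℝ} (hs : 0 ≤ s) (hc : 0 ≤ c) {z : ℂ}
    (hz : z ∈ upperHalf)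
    (h : ∑ i ∈ Finset.range (k + 1), ((k + l + 1).choose i : ℂ) * (c : ℂ) ^ (k - i) * (s + z) ^ i
      = 0) : z ∈ rootCone (k + l + 1) := by
  set q : ℝ := (k.factorial * l.factorial : ℝ) / (k + l + 1).factorial with hq
  have hq0 : 0 < q := by positivity
  let P : ℝ[X] := C q * ∑ i ∈ Finset.range (k + 1),
    C (((k + l + 1).choose i : ℝ) * c ^ (k - i)) * (C s + X) ^ i
  have hdeg : P.natDegree ≤ k + l + 1 := by
    refine (natDegree_C_mul_le _ _).trans (natDegree_sum_le_of_forall_le _ _ fun i hi => ?_)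
    have hik : i ≤ k := Nat.lt_succ_iff.1 (Finset.mem_range.1 hi)
    refine (natDegree_C_mul_le _ _).trans (natDegree_pow_le.trans ?_)
    rw [natDegree_C_add, natDegree_X]
    omega
  have hvol := fun (t : ℝ) (ht : 0 ≤ t) => volume_real_coneBody_add k l hs hc ht
  refine ⟨hz, coneBody k l hs hc, flatCube k l, _, ?_,
    isSteinerPolynomial_map (P := P) hdeg fun t ht => ?_, ?_⟩
  · refine dim_eq_of_volume_pos ?_
    have h1 := hvol 1 zero_le_one
    rw [show (1 : ℝ) • flatCube k l = flatCube k l from ConvexBody.ext (by simp)] at h1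
    rw [h1]
    refine (mul_pos hq0 (Finset.sum_pos' (fun i _ => by positivity)
      ⟨k, Finset.self_mem_range_succ k, ?_⟩)).ne'
    have : 0 < (k + l + 1).choose k := Nat.choose_pos (by omega)
    rw [Nat.sub_self, pow_zero]
    positivity
  · rw [hvol t ht]
    simp [P, eval_finsetSum, hq]
  · simp only [IsRoot.def, P, Polynomial.map_mul, Polynomial.map_sum, Polynomial.map_pow,
      Polynomial.map_add, map_C, map_X, eval_mul, eval_finsetSum, eval_pow, eval_add, eval_C, eval_X]
    refine mul_eq_zero_of_right _ ?_
    rw [← h]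
    simp

/-! ### Reaching every admissible point -/

theorem exists_mem_rootCone {z : ℂ} (hz : z ∈ upperHalf \ posReal) :
    ∃ m : ℕ, 2 ≤ m ∧ ∀ n : ℕ, m ≤ n → z ∈ rootCone n := by
  have him : 0 ≤ z.im := hz.1
  rcases him.eq_or_lt with h0 | h0
  · have hre : z.re ≤ 0 := by
      by_contra! hlt
      exact hz.2 ⟨hlt, h0.symm⟩
    refine ⟨2, le_rfl, fun n hn => ?_⟩
    obtain ⟨l, rfl⟩ : ∃ l, n = 1 + l + 1 := ⟨n - 2, by omega⟩
    -- With `c = 0` and `k = 1` only the linear term survives, with root `-s`.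
    refine mem_rootCone_of_sum_eq_zero (s := -z.re) (c := 0) (by linarith) le_rfl hz.1 ?_
    have e : ((-z.re : ℝ) : ℂ) + z = 0 := by
      apply Complex.ext <;> simp [← h0]
    rw [e]
    simp [Finset.sum_range_succ]
  · obtain ⟨k, hk, hroot⟩ := exists_root_truncBinom (z.re / z.im)
    refine ⟨2 * k, by omega, fun n hn => ?_⟩
    obtain ⟨w, hw, hwz, hw0⟩ := hroot n hn
    obtain ⟨l, rfl⟩ : ∃ l, n = k + l + 1 := ⟨n - k - 1, by omega⟩
    have hc : 0 < z.im / w.im := div_pos h0 hw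
    -- Scaling by `c` matches the imaginary parts; `s` shifts the real part, and `s ≥ 0` because `w`
    -- is at least as close in angle to the positive axis as `z`.
    refine mem_rootCone_of_sum_eq_zero (s := z.im / w.im * w.re - z.re) (c := z.im / w.im) ?_ hc.le
      hz.1 ?_
    · have := mul_le_mul_of_nonneg_left hwz hc.le
      have e : z.im / w.im * (z.re / z.im * w.im) = z.re := by field_simp
      linarith
    · have e : ((z.im / w.im * w.re - z.re : ℝ) : ℂ) + z = ((z.im / w.im : ℝ) : ℂ) * w := by
        apply Complex.ext
        · simp
        · simp only [Complex.add_im, Complex.ofReal_im, zero_add, Complex.im_ofReal_mul]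
          field_simp
      rw [e]
      simp only [truncBinom, map_sum, map_mul, aeval_X, map_pow, map_natCast] at hw0
      rw [← mul_zero (((z.im / w.im : ℝ) : ℂ) ^ k), ← hw0, Finset.mul_sum]
      refine Finset.sum_congr rfl fun i hi => ?_
      have hik : i ≤ k := Nat.lt_succ_iff.1 (Finset.mem_range.1 hi)
      rw [mul_pow, ← pow_sub_mul_pow _ hik]
      ring

/-! ### Positive reals are not roots -/

/-- Full-dimensionality of `K + E` gives positive volume to all `K + t E`. -/
lemma volume_real_add_smul_pos {n : ℕ} {K E : Body n} (h : dim (K + E) = n) {t : ℝ} (ht : 0 < t) :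
    0 < (volume : Measure (EuclideanSpace ℝ (Fin n))).real
      ((K + t • E : Body n) : Set (EuclideanSpace ℝ (Fin n))) := by
  obtain ⟨x, hx⟩ := K.nonempty
  obtain ⟨y, hy⟩ := E.nonempty
  have hspan : affineSpan ℝ ((K + E : Body n) : Set (EuclideanSpace ℝ (Fin n))) = ⊤ := by
    rw [AffineSubspace.affineSpan_eq_top_iff_vectorSpan_eq_top_of_nonempty _ _ _ (K + E).nonempty]
    refine Submodule.eq_top_of_finrank_eq ?_
    rw [finrank_euclideanSpace_fin]
    exact h
  have hint := (K + E).convex.interior_nonempty_iff_affineSpan_eq_top.2 hspan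
  set r : ℝ := min 1 t with hr
  have hr0 : 0 < r := lt_min one_pos ht
  -- Contracting `K` towards `x` by `r` and `E` towards `y` by `r/t` keeps both inside; `r = min 1
  -- t` makes both factors at most 1.
  have hsub : (fun v => ((1 - r) • x + (t - r) • y) + v) '' (r • ((K + E : Body n) : Set _))
      ⊆ ((K + t • E : Body n) : Set (EuclideanSpace ℝ (Fin n))) := by
    rintro _ ⟨_, ⟨_, ⟨a, ha, b, hb, rfl⟩, rfl⟩, rfl⟩
    have h1 : (1 - r) • x + r • a ∈ K :=
      K.convex hx ha (sub_nonneg.2 (min_le_left _ _)) hr0.le (by ring)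
    have h2 : (1 - r / t) • y + (r / t) • b ∈ E :=
      E.convex hy hb (sub_nonneg.2 ((div_le_one ht).2 (min_le_right _ _))) (by positivity) (by ring)
    refine ⟨_, h1, _, ⟨_, h2, rfl⟩, ?_⟩
    simp only [smul_add, smul_smul, mul_sub, mul_div_cancel₀ _ ht.ne', mul_one]
    abel
  have hpos : 0 < (volume : Measure (EuclideanSpace ℝ (Fin n)))
      ((K + E : Body n) : Set (EuclideanSpace ℝ (Fin n))) :=
    Measure.measure_pos_of_nonempty_interior _ hint
  refine ENNReal.toReal_pos (ne_of_gt (lt_of_lt_of_le ?_ (measure_mono hsub)))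
    (K + t • E).isCompact.measure_lt_top.ne
  rw [Set.image_add_left, measure_preimage_add, Measure.addHaar_smul]
  exact ENNReal.mul_pos (by simpa using fun h => (hr0.ne' h).elim) hpos.ne'

theorem rootCone_subset {n : ℕ} : rootCone n ⊆ upperHalf \ posReal := by
  rintro z ⟨hz, K, E, f, hdim, ⟨W, hW, rfl⟩, hroot⟩
  refine ⟨hz, fun hpos => ?_⟩
  have hzr : z = ((z.re : ℝ) : ℂ) := Complex.ext rfl (by simpa using hpos.2)
  have hv := volume_real_add_smul_pos hdim hpos.1
  rw [hW _ hpos.1.le] at hv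
  rw [IsRoot.def, eval_finsetSum, hzr] at hroot
  simp only [eval_mul, eval_C, eval_pow, eval_X] at hroot
  exact hv.ne' (by exact_mod_cast hroot)

end Steiner

theorem theorem1p8 :
    (∀ γ : ℂ, γ ∈ Steiner.upperHalf \ Steiner.posReal →
      ∃ nγ : ℕ, 2 ≤ nγ ∧ ∀ n : ℕ, nγ ≤ n → γ ∈ Steiner.rootCone n) ∧
    (⋃ n ≥ 2, Steiner.rootCone n) = Steiner.upperHalf \ Steiner.posReal := by
  refine ⟨fun γ hγ => Steiner.exists_mem_rootCone hγ, Set.Subset.antisymm ?_ fun γ hγ => ?_⟩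
  · exact Set.iUnion₂_subset fun n _ => Steiner.rootCone_subset
  · obtain ⟨m, hm, h⟩ := Steiner.exists_mem_rootCone hγ
    exact Set.mem_iUnion₂.2 ⟨m, hm, h m le_rfl⟩
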